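/- A \emph{partially ordered pattern} (POP) $p$ of length $k$ is a poset $P$ on the label set $\{1,\dots,k\}$. An \emph{occurrence} of $p$ in a permutation $\pi=\pi_1\cdots\pi_n$ is a subsequence $\pi_{i_1}\cdots\pi_{i_k}$ with $1\le i_1<\cdots<i_k\le n$ such that $\pi_{i_j}<\pi_{i_m}$ whenever $j<m$ in $P$; $\pi$ \emph{avoids} $p$ if it contains no occurrence of $p$. Let $p$ be the POP of length $5$ whose only relation is $1>5$ (the labels $2,3,4$ are isolated), and let $a(n)$ be the number of permutations of $\{1,\dots,n\}$ that avoid $p$. Then, as formal power series over $\mathbb{Q}$, $$\sum_{n\ge 0}a(n)x^n=\frac{1-x^2}{1-x-2x^2-2x^3-12x^4-8x^5+2x^6+5x^7+x^8}.$$ Moreover, $(a(n))_{n\ge 0}$ is the sequence A276838 of the OEIS: for every $n\ge 0$, $a(n)$ equals the number of permutations of $\{1,\dots,n\}$ such that for each cycle $c$ the smallest integer interval containing all elements of $c$ has at most $4$ elements. -/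

import Mathlib

/-- A partially ordered pattern (POP) of length `k`: a poset on the labels `1, …, k`.
The label `j` is represented by the element `j - 1` of `Fin k`. -/
structure POP (k : ℕ) where
  order : PartialOrder (Fin k)

namespace POP

/-- `j` is strictly below `m` in the poset of the pattern. -/
def Below {k : ℕ} (p : POP k) (j m : Fin k) : Prop := p.order.lt j m

/-- The subsequence of `π` at the positions `i 0 < i 1 < ⋯ < i (k - 1)` is an occurrence of `p`:
its entries satisfy all the relations of the poset. -/
def IsOccurrence {k n : ℕ} (p : POP k) (π : Equiv.Perm (Fin n)) (i : Fin k → Fin n) : Prop :=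
  StrictMono i ∧ ∀ j m : Fin k, p.Below j m → π (i j) < π (i m)

/-- `π` avoids `p`: there is no occurrence of `p` in `π`. -/
def Avoids {k n : ℕ} (p : POP k) (π : Equiv.Perm (Fin n)) : Prop :=
  ¬ ∃ i : Fin k → Fin n, p.IsOccurrence π i

/-- The number of `n`-permutations that avoid `p`. -/
noncomputable def avoidCount {k : ℕ} (p : POP k) (n : ℕ) : ℕ :=
  Nat.card {π : Equiv.Perm (Fin n) // p.Avoids π}

/-- The POP of length 5 whose only relation is `1 > 5`; the labels `2`, `3`, `4` are isolated. -/
def oneAboveFive : POP 5 where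
  order :=
    { le := fun a b => a = b ∨ (a = 4 ∧ b = 0)
      lt := fun a b => a = 4 ∧ b = 0
      le_refl := fun _ => Or.inl rfl
      le_trans := by decide
      lt_iff_le_not_ge := by decide
      le_antisymm := by decide }

end POP

/-- The elements of the cycle of `π` through `x` (fixed points are cycles of length one). -/
def cycleElements {n : ℕ} (π : Equiv.Perm (Fin n)) (x : Fin n) : Finset (Fin n) :=
  Finset.univ.filter fun y => π.SameCycle x y

theorem cycleElements_nonempty {n : ℕ} (π : Equiv.Perm (Fin n)) (x : Fin n) :
    (cycleElements π x).Nonempty :=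
  ⟨x, Finset.mem_filter.mpr ⟨Finset.mem_univ x, Equiv.Perm.SameCycle.refl π x⟩⟩

/-- The smallest integer interval that contains all elements of the cycle of `π` through `x`. -/
def cycleInterval {n : ℕ} (π : Equiv.Perm (Fin n)) (x : Fin n) : Finset (Fin n) :=
  Finset.Icc ((cycleElements π x).min' (cycleElements_nonempty π x))
    ((cycleElements π x).max' (cycleElements_nonempty π x))

/-- The number of `n`-permutations such that for each cycle the smallest integer interval
containing all its elements has at most `m` elements. For `m = 4` this is the OEIS sequence
A276838. -/
noncomputable def localCycleCount (m n : ℕ) : ℕ :=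
  Nat.card {π : Equiv.Perm (Fin n) // ∀ x : Fin n, (cycleInterval π x).card ≤ m}

open Finset

/-! Both classes are governed by one condition: related elements satisfy `y ≤ x + 3`. For the
pattern, `x` and `y` are positions and the relation is `π y ≤ π x`; for cycles it is membership in a
common cycle. In both cases a permutation grows uniquely by a new least element `0`, isolated or
attached to some `q`. Old labels shift by one, and an attached `0` inherits everything related to
`q`, so the condition survives exactly when `q` reaches no further than `2`. How many `q` qualify,
and what follows, depends only on the numbers `a`, `b`, `c` of elements of reach at most `0`, `1`,
`2`. Hence both counts equal `insertionCount n 0 0 0` (`InsertionFamily.card_good`), whose finite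
system of states yields the rational series (`insertionCount_recurrence`). -/

/-- The number of ways to insert `n` further minimal elements, one after the other, into a
structure in which `a`, `b`, `c` elements have reach at most `0`, `1`, `2`. -/
def insertionCount : ℕ → ℕ → ℕ → ℕ → ℕ
  | 0, _, _, _ => 1
  | n + 1, a, b, c =>
    insertionCount n 1 (a + 1) (b + 1) + a * insertionCount n 0 (a + 1) (b + 1)
      + (b - a) * insertionCount n 0 a (b + 1) + (c - b) * insertionCount n 0 a b

/-- Starting from `(0, 0, 0)`, only states with `a ≤ 1`, `b ≤ 2`, `c ≤ 3` arise. Unfolding every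
term down to `n` leaves a linear identity between the values at these states. -/
theorem insertionCount_recurrence (n : ℕ) :
    insertionCount (n + 8) 0 0 0 + 2 * insertionCount (n + 2) 0 0 0
        + 5 * insertionCount (n + 1) 0 0 0 + insertionCount n 0 0 0 =
      insertionCount (n + 7) 0 0 0 + 2 * insertionCount (n + 6) 0 0 0
        + 2 * insertionCount (n + 5) 0 0 0 + 12 * insertionCount (n + 4) 0 0 0
        + 8 * insertionCount (n + 3) 0 0 0 := by
  simp only [insertionCount, Nat.reduceAdd, Nat.reduceSub, zero_mul, add_zero, one_mul, zero_add,
    Nat.sub_self, Nat.sub_zero]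
  ring

theorem mk_insertionCount :
    PowerSeries.mk (fun n : ℕ => (insertionCount n 0 0 0 : ℚ)) =
      (1 - PowerSeries.X ^ 2) *
        (1 - PowerSeries.X - 2 * PowerSeries.X ^ 2 - 2 * PowerSeries.X ^ 3
          - 12 * PowerSeries.X ^ 4 - 8 * PowerSeries.X ^ 5 + 2 * PowerSeries.X ^ 6
          + 5 * PowerSeries.X ^ 7 + PowerSeries.X ^ 8)⁻¹ := by
  rw [PowerSeries.eq_mul_inv_iff_mul_eq (by simp)]
  have two : (2 : PowerSeries ℚ) = PowerSeries.C 2 := (map_ofNat PowerSeries.C _).symm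
  have five : (5 : PowerSeries ℚ) = PowerSeries.C 5 := (map_ofNat PowerSeries.C _).symm
  have eight : (8 : PowerSeries ℚ) = PowerSeries.C 8 := (map_ofNat PowerSeries.C _).symm
  have twelve : (12 : PowerSeries ℚ) = PowerSeries.C 12 := (map_ofNat PowerSeries.C _).symm
  ext n
  -- The denominator has degree `8`: the recurrence applies from there on, and the earlier
  -- coefficients are computed.
  rcases lt_or_ge n 8 with h | h
  · rw [two, five, eight, twelve]
    interval_cases n <;>
      simp [mul_add, mul_sub, PowerSeries.coeff_mul_X_pow', PowerSeries.coeff_X_pow,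
        PowerSeries.coeff_one, mul_left_comm _ (PowerSeries.C _), PowerSeries.coeff_C_mul,
        PowerSeries.coeff_succ_mul_X, insertionCount] <;> norm_num
  · obtain ⟨n, rfl⟩ := Nat.exists_eq_add_of_le' h
    have key := congrArg (Nat.cast : ℕ → ℚ) (insertionCount_recurrence n)
    push_cast at key
    rw [two, five, eight, twelve]
    simp [mul_add, mul_sub, PowerSeries.coeff_mul_X_pow', PowerSeries.coeff_X_pow,
        PowerSeries.coeff_one, mul_left_comm _ (PowerSeries.C _), PowerSeries.coeff_C_mul,
        PowerSeries.coeff_succ_mul_X]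
    linarith

/-! ### Growth by minimal elements and the transfer of reach counts -/

/-- A family of reflexive relations on `Fin n`, indexed by permutations of `Fin n`, in which the
permutations of `Fin (n + 1)` arise from those of `Fin n` by inserting a new minimal element `0`,
either isolated or attached to an element `q`. -/
structure InsertionFamily where
  rel : ∀ {n : ℕ}, Equiv.Perm (Fin n) → Fin n → Fin n → Prop
  insert : ∀ {n : ℕ}, Fin (n + 1) → Equiv.Perm (Fin n) → Equiv.Perm (Fin (n + 1))
  rel_refl : ∀ {n : ℕ} (σ : Equiv.Perm (Fin n)) (x : Fin n), rel σ x x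
  insert_bijective : ∀ n : ℕ, Function.Bijective fun z : Fin (n + 1) × Equiv.Perm (Fin n) =>
    insert z.1 z.2
  rel_succ_succ : ∀ {n : ℕ} (p : Fin (n + 1)) (σ : Equiv.Perm (Fin n)) (x y : Fin n),
    rel (insert p σ) x.succ y.succ ↔ rel σ x y
  rel_zero_succ : ∀ {n : ℕ} (p : Fin (n + 1)) (σ : Equiv.Perm (Fin n)) (y : Fin n),
    rel (insert p σ) 0 y.succ ↔ ∃ q : Fin n, p = q.succ ∧ rel σ q y

namespace InsertionFamily

variable (F : InsertionFamily) {n : ℕ}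

/-- All elements related to `x` are at most `j`. -/
def ReachLE (σ : Equiv.Perm (Fin n)) (x : Fin n) (j : ℕ) : Prop := ∀ y, F.rel σ x y → (y : ℕ) ≤ j

/-- Related elements exceed each other by at most `3`. -/
def Good (σ : Equiv.Perm (Fin n)) : Prop := ∀ x : Fin n, F.ReachLE σ x (x + 3)

open Classical in
/-- The number of elements of reach at most `j`. -/
noncomputable def reachCount (σ : Equiv.Perm (Fin n)) (j : ℕ) : ℕ := #{x | F.ReachLE σ x j}

variable {F}

theorem ReachLE.mono {σ : Equiv.Perm (Fin n)} {x : Fin n} {i j : ℕ} (h : F.ReachLE σ x i)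
    (hij : i ≤ j) : F.ReachLE σ x j := fun y hy => (h y hy).trans hij

theorem reachLE_succ_succ (p : Fin (n + 1)) (σ : Equiv.Perm (Fin n)) (x : Fin n) (j : ℕ) :
    F.ReachLE (F.insert p σ) x.succ (j + 1) ↔ F.ReachLE σ x j := by
  simp [ReachLE, Fin.forall_fin_succ, F.rel_succ_succ]

theorem not_reachLE_succ_zero (p : Fin (n + 1)) (σ : Equiv.Perm (Fin n)) (x : Fin n) :
    ¬ F.ReachLE (F.insert p σ) x.succ 0 := fun h => by
  simpa using h _ (F.rel_refl _ _)

theorem reachLE_zero_of_zero (σ : Equiv.Perm (Fin n)) (j : ℕ) :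
    F.ReachLE (F.insert 0 σ) 0 j := by
  simp [ReachLE, Fin.forall_fin_succ, F.rel_zero_succ, (Fin.succ_ne_zero _).symm]

theorem reachLE_zero_of_succ (q : Fin n) (σ : Equiv.Perm (Fin n)) (j : ℕ) :
    F.ReachLE (F.insert q.succ σ) 0 (j + 1) ↔ F.ReachLE σ q j := by
  simp [ReachLE, Fin.forall_fin_succ, F.rel_zero_succ]

theorem not_reachLE_zero_of_succ (q : Fin n) (σ : Equiv.Perm (Fin n)) :
    ¬ F.ReachLE (F.insert q.succ σ) 0 0 := fun h => by
  simpa using h q.succ ((F.rel_zero_succ _ _ _).2 ⟨q, rfl, F.rel_refl _ _⟩)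

theorem good_insert_zero (σ : Equiv.Perm (Fin n)) : F.Good (F.insert 0 σ) ↔ F.Good σ := by
  simp [Good, Fin.forall_fin_succ, reachLE_zero_of_zero, add_right_comm _ 1, reachLE_succ_succ]

theorem good_insert_succ (q : Fin n) (σ : Equiv.Perm (Fin n)) :
    F.Good (F.insert q.succ σ) ↔ F.ReachLE σ q 2 ∧ F.Good σ := by
  simp [Good, Fin.forall_fin_succ, reachLE_zero_of_succ q σ 2, add_right_comm _ 1,
    reachLE_succ_succ]

open Classical in
theorem reachCount_insert (p : Fin (n + 1)) (σ : Equiv.Perm (Fin n)) (j : ℕ) :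
    F.reachCount (F.insert p σ) (j + 1) =
      (if F.ReachLE (F.insert p σ) 0 (j + 1) then 1 else 0) + F.reachCount σ j := by
  simp only [reachCount, card_filter, Fin.sum_univ_succ, reachLE_succ_succ]

open Classical in
theorem reachCount_insert_zero (p : Fin (n + 1)) (σ : Equiv.Perm (Fin n)) :
    F.reachCount (F.insert p σ) 0 = if F.ReachLE (F.insert p σ) 0 0 then 1 else 0 := by
  simp only [reachCount, card_filter, Fin.sum_univ_succ, not_reachLE_succ_zero, if_false,
    sum_const_zero, add_zero]

variable (F)

/-- The number of completions of `σ` by `k` further insertions. -/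
noncomputable def weight (k : ℕ) (σ : Equiv.Perm (Fin n)) : ℕ :=
  insertionCount k (F.reachCount σ 0) (F.reachCount σ 1) (F.reachCount σ 2)

variable {F}

theorem weight_insert_zero (k : ℕ) (σ : Equiv.Perm (Fin n)) :
    F.weight k (F.insert 0 σ) =
      insertionCount k 1 (F.reachCount σ 0 + 1) (F.reachCount σ 1 + 1) := by
  simp [weight, reachCount_insert _ _ 0, reachCount_insert _ _ 1, reachCount_insert_zero,
    reachLE_zero_of_zero, add_comm]

open Classical in
theorem weight_insert_succ (k : ℕ) (q : Fin n) (σ : Equiv.Perm (Fin n)) :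
    F.weight k (F.insert q.succ σ) =
      insertionCount k 0 (F.reachCount σ 0 + if F.ReachLE σ q 0 then 1 else 0)
        (F.reachCount σ 1 + if F.ReachLE σ q 1 then 1 else 0) := by
  simp only [weight, reachCount_insert _ _ 0, reachCount_insert _ _ 1, reachCount_insert_zero,
    reachLE_zero_of_succ, not_reachLE_zero_of_succ, if_false, add_comm]

-- The admissible `q` split by exact reach `0`, `1`, `2` into classes of sizes `a`, `b - a`, `c -
-- b`; within a class the new state is the same.
open Classical in
theorem sum_weight_insert_succ (k : ℕ) (σ : Equiv.Perm (Fin n)) :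
    ∑ q : Fin n with F.ReachLE σ q 2, F.weight k (F.insert q.succ σ) =
      F.reachCount σ 0 * insertionCount k 0 (F.reachCount σ 0 + 1) (F.reachCount σ 1 + 1)
        + (F.reachCount σ 1 - F.reachCount σ 0) *
          insertionCount k 0 (F.reachCount σ 0) (F.reachCount σ 1 + 1)
        + (F.reachCount σ 2 - F.reachCount σ 1) *
          insertionCount k 0 (F.reachCount σ 0) (F.reachCount σ 1) := by
  set S : ℕ → Finset (Fin n) := fun j => {q | F.ReachLE σ q j} with hS
  have hmono : ∀ j, S j ⊆ S (j + 1) := fun j q hq => by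
    simp only [hS, mem_filter_univ] at hq ⊢
    exact hq.mono j.le_succ
  have hcard : ∀ j, F.reachCount σ j = #(S j) := fun _ => rfl
  change ∑ q ∈ S 2, _ = _
  rw [← sum_sdiff (hmono 1), ← sum_sdiff (hmono 0)]
  have h0 : ∀ q ∈ S 0, F.weight k (F.insert q.succ σ) =
      insertionCount k 0 (F.reachCount σ 0 + 1) (F.reachCount σ 1 + 1) := fun q hq => by
    have hq0 : F.ReachLE σ q 0 := by simpa [hS] using hq
    rw [weight_insert_succ, if_pos hq0, if_pos (hq0.mono zero_le_one)]
  have h1 : ∀ q ∈ S 1 \ S 0, F.weight k (F.insert q.succ σ) =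
      insertionCount k 0 (F.reachCount σ 0) (F.reachCount σ 1 + 1) := fun q hq => by
    have hq' : F.ReachLE σ q 1 ∧ ¬ F.ReachLE σ q 0 := by simpa [hS] using hq
    rw [weight_insert_succ, if_neg hq'.2, if_pos hq'.1, add_zero]
  have h2 : ∀ q ∈ S 2 \ S 1, F.weight k (F.insert q.succ σ) =
      insertionCount k 0 (F.reachCount σ 0) (F.reachCount σ 1) := fun q hq => by
    have hq' : F.ReachLE σ q 2 ∧ ¬ F.ReachLE σ q 1 := by simpa [hS] using hq
    rw [weight_insert_succ, if_neg hq'.2, if_neg fun h => hq'.2 (h.mono zero_le_one),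
      add_zero, add_zero]
  rw [sum_congr rfl h0, sum_congr rfl h1, sum_congr rfl h2]
  simp only [sum_const, smul_eq_mul, card_sdiff_of_subset (hmono _), ← hcard]
  ring

open Classical in
theorem sum_weight_succ (F : InsertionFamily) (n k : ℕ) :
    ∑ σ : Equiv.Perm (Fin (n + 1)) with F.Good σ, F.weight k σ =
      ∑ σ : Equiv.Perm (Fin n) with F.Good σ, F.weight (k + 1) σ := by
  rw [sum_filter, ← (F.insert_bijective n).sum_comp, Fintype.sum_prod_type_right, sum_filter]
  refine sum_congr rfl fun σ _ => ?_
  rw [Fin.sum_univ_succ]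
  by_cases h : F.Good σ
  · simp only [good_insert_zero, good_insert_succ, h, and_true, if_true]
    rw [← sum_filter, sum_weight_insert_succ, weight_insert_zero, weight, insertionCount]
    ring
  · simp [good_insert_zero, good_insert_succ, h]

-- Moving one insertion from the weight into the permutation preserves the sum, so everything
-- reduces to the empty permutation.
open Classical in
theorem sum_weight (F : InsertionFamily) (n k : ℕ) :
    ∑ σ : Equiv.Perm (Fin n) with F.Good σ, F.weight k σ = insertionCount (n + k) 0 0 0 := by
  induction n generalizing k with
  | zero => simp [Good, weight, reachCount, filter_true_of_mem]
  | succ n ih => rw [sum_weight_succ, ih, Nat.succ_add_eq_add_succ]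

theorem card_good (F : InsertionFamily) (n : ℕ) :
    Nat.card {σ : Equiv.Perm (Fin n) // F.Good σ} = insertionCount n 0 0 0 := by
  classical
  rw [Nat.card_eq_fintype_card, Fintype.card_subtype, card_eq_sum_ones]
  exact F.sum_weight n 0

end InsertionFamily

/-! ### The family of the pattern -/

/-- The permutation that puts the new minimal value `0` at the position `j`. -/
def insertMinAt {n : ℕ} (j : Fin (n + 1)) (π : Equiv.Perm (Fin n)) : Equiv.Perm (Fin (n + 1)) :=
  (finSuccEquiv' 0).trans (π.optionCongr.trans (finSuccEquiv' j).symm)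

@[simp]
theorem insertMinAt_zero {n : ℕ} (j : Fin (n + 1)) (π : Equiv.Perm (Fin n)) :
    insertMinAt j π 0 = j := by simp [insertMinAt]

@[simp]
theorem insertMinAt_succ {n : ℕ} (j : Fin (n + 1)) (π : Equiv.Perm (Fin n)) (x : Fin n) :
    insertMinAt j π x.succ = j.succAbove (π x) := by
  have h : finSuccEquiv' 0 x.succ = some x := by simp
  simp [insertMinAt, h]

/-- The place directly after the element `q` of `π` if `p = q + 1`, the first place if `p = 0`. -/
def placeAfter {n : ℕ} (π : Equiv.Perm (Fin n)) (p : Fin (n + 1)) : Fin (n + 1) :=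
  Fin.cases 0 (fun q => (π q).succ) p

theorem placeAfter_injective {n : ℕ} (π : Equiv.Perm (Fin n)) :
    Function.Injective (placeAfter π) := by
  intro p p'
  cases p using Fin.cases <;> cases p' using Fin.cases <;>
    simp [placeAfter, Fin.succ_ne_zero, (Fin.succ_ne_zero _).symm]

/-- The relation `π y ≤ π x`, with insertion of a minimal value after a given one. -/
def precedenceFamily : InsertionFamily where
  rel π x y := π y ≤ π x
  insert p π := insertMinAt (placeAfter π p) π
  rel_refl _ _ := le_rfl
  insert_bijective n := by
    rw [Fintype.bijective_iff_injective_and_card]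
    refine ⟨?_, by simp [Fintype.card_perm, Nat.factorial_succ]⟩
    rintro ⟨p, π⟩ ⟨p', π'⟩ h
    have hj : placeAfter π p = placeAfter π' p' := by simpa using DFunLike.congr_fun h 0
    have hπ : π = π' := Equiv.ext fun x => by
      have := DFunLike.congr_fun h x.succ
      simp only [insertMinAt_succ, hj] at this
      exact Fin.succAbove_right_injective this
    subst hπ
    rw [placeAfter_injective π hj]
  rel_succ_succ p π x y := by simp
  rel_zero_succ p π y := by
    cases p using Fin.cases with
    | zero => simp [placeAfter, (Fin.succ_ne_zero _).symm]
    | succ q =>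
      simp only [placeAfter, Fin.cases_succ, insertMinAt_zero, insertMinAt_succ, Fin.succ_inj]
      rw [← not_lt, Fin.lt_succAbove_iff_le_castSucc, Fin.succ_le_castSucc_iff, not_lt]
      simp

/-! ### The family of cycles -/

theorem sameCycle_insert_of_apply {n : ℕ} (p : Fin (n + 1)) (σ : Equiv.Perm (Fin n)) (x : Fin n) :
    (Equiv.Perm.decomposeFin.symm (p, σ)).SameCycle x.succ (σ x).succ := by
  set τ := Equiv.Perm.decomposeFin.symm (p, σ) with hτ
  have h0 : τ 0 = p := by simp [hτ]
  have hs : τ x.succ = Equiv.swap 0 p (σ x).succ := by simp [hτ]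
  by_cases h : (σ x).succ = p
  -- Here `0` has been spliced in between `x` and `σ x`, so the path takes two steps.
  · refine ⟨2, ?_⟩
    rw [h, Equiv.swap_apply_right] at hs
    rw [zpow_two, Equiv.Perm.mul_apply, hs, h0, h]
  · refine ⟨1, ?_⟩
    rw [zpow_one, hs, Equiv.swap_apply_of_ne_of_ne (Fin.succ_ne_zero _) h]

theorem sameCycle_insert_of_sameCycle {n : ℕ} (p : Fin (n + 1)) {σ : Equiv.Perm (Fin n)}
    {x y : Fin n} (h : σ.SameCycle x y) :
    (Equiv.Perm.decomposeFin.symm (p, σ)).SameCycle x.succ y.succ := by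
  obtain ⟨i, -, rfl⟩ := h.exists_pow_eq'
  induction i with
  | zero => rfl
  | succ i ih =>
    rw [pow_succ', Equiv.Perm.mul_apply]
    exact (ih ⟨i, rfl⟩).trans (sameCycle_insert_of_apply p σ _)

/-- The relation on `Fin (n + 1)` that extends the cycles of `σ` by `0`, put into the cycle of `q`
if `p = q + 1` and isolated if `p = 0`. -/
def extendedCycleRel {n : ℕ} (p : Fin (n + 1)) (σ : Equiv.Perm (Fin n)) (z : Fin (n + 1))
    (y : Fin n) : Prop :=
  Fin.cases (∃ q : Fin n, p = q.succ ∧ σ.SameCycle q y) (fun x => σ.SameCycle x y) z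

/-- Invariance under one step makes the relation constant along cycles, so the insertion merges no
two old cycles. -/
theorem extendedCycleRel_apply {n : ℕ} (p : Fin (n + 1)) (σ : Equiv.Perm (Fin n))
    (z : Fin (n + 1)) (y : Fin n) :
    extendedCycleRel p σ (Equiv.Perm.decomposeFin.symm (p, σ) z) y ↔ extendedCycleRel p σ z y := by
  cases z using Fin.cases with
  | zero =>
    cases p using Fin.cases with
    | zero => simp [extendedCycleRel]
    | succ q => simp [extendedCycleRel]
  | succ x =>
    rw [Equiv.Perm.decomposeFin_symm_apply_succ]
    by_cases h : (σ x).succ = p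
    · subst h
      simp [extendedCycleRel]
    · rw [Equiv.swap_apply_of_ne_of_ne (Fin.succ_ne_zero _) h]
      simp [extendedCycleRel]

theorem extendedCycleRel_iff_of_sameCycle {n : ℕ} {p : Fin (n + 1)} {σ : Equiv.Perm (Fin n)}
    {z w : Fin (n + 1)} (h : (Equiv.Perm.decomposeFin.symm (p, σ)).SameCycle z w) (y : Fin n) :
    extendedCycleRel p σ w y ↔ extendedCycleRel p σ z y := by
  obtain ⟨i, -, rfl⟩ := h.exists_pow_eq'
  induction i with
  | zero => rfl
  | succ i ih => rw [pow_succ', Equiv.Perm.mul_apply, extendedCycleRel_apply, ih ⟨i, rfl⟩]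

theorem sameCycle_insert_succ {n : ℕ} (p : Fin (n + 1)) (σ : Equiv.Perm (Fin n))
    (z : Fin (n + 1)) (y : Fin n) :
    (Equiv.Perm.decomposeFin.symm (p, σ)).SameCycle z y.succ ↔ extendedCycleRel p σ z y := by
  refine ⟨fun h => (extendedCycleRel_iff_of_sameCycle h y).1 ?_, fun h => ?_⟩
  · exact Equiv.Perm.SameCycle.refl σ y
  · cases z using Fin.cases with
    | zero =>
      obtain ⟨q, rfl, hq⟩ := h
      refine Equiv.Perm.SameCycle.trans ⟨1, ?_⟩ (sameCycle_insert_of_sameCycle _ hq)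
      simp
    | succ x => exact sameCycle_insert_of_sameCycle p h

/-- The relation of lying in the same cycle, with insertion of a minimal element into a cycle. -/
def sameCycleFamily : InsertionFamily where
  rel σ x y := σ.SameCycle x y
  insert p σ := Equiv.Perm.decomposeFin.symm (p, σ)
  rel_refl σ x := Equiv.Perm.SameCycle.refl σ x
  insert_bijective _ := Equiv.Perm.decomposeFin.symm.bijective
  rel_succ_succ p σ x y := sameCycle_insert_succ p σ x.succ y
  rel_zero_succ p σ y := sameCycle_insert_succ p σ 0 y

/-! ### Both classes as good permutations -/

theorem avoids_oneAboveFive_iff {n : ℕ} (π : Equiv.Perm (Fin n)) :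
    POP.oneAboveFive.Avoids π ↔ precedenceFamily.Good π := by
  have key : POP.oneAboveFive.Avoids π ↔ ∀ x y : Fin n, (x : ℕ) + 4 ≤ y → π x < π y := by
    constructor
    · intro h x y hxy
      by_contra hlt
      have hne : x ≠ y := fun e => by subst e; omega
      -- The isolated labels are free, so the positions `x, x + 1, x + 2, x + 3, y` serve.
      refine h ⟨fun j => if j = 4 then y else ⟨x + j, by omega⟩, ?_, ?_⟩
      · refine Fin.strictMono_iff_lt_succ.2 fun i => ?_
        fin_cases i <;> (simp [Fin.lt_def]; try omega)
      · rintro j m ⟨rfl, rfl⟩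
        simpa using lt_of_le_of_ne (not_lt.1 hlt) fun e => hne (π.injective e.symm)
    · rintro h ⟨i, hi, hrel⟩
      have h01 : i 0 < i 1 := hi (by decide)
      have h12 : i 1 < i 2 := hi (by decide)
      have h23 : i 2 < i 3 := hi (by decide)
      have h34 : i 3 < i 4 := hi (by decide)
      exact lt_asymm (hrel 4 0 ⟨rfl, rfl⟩) (h _ _ (by simp only [Fin.lt_def] at *; omega))
  rw [key]
  refine forall₂_congr fun x y => ?_
  change _ ↔ (π y ≤ π x → _)
  rw [← not_imp_not, not_lt]
  refine imp_congr_right fun _ => ?_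
  omega

theorem cycleInterval_card_le_four_iff {n : ℕ} (σ : Equiv.Perm (Fin n)) :
    (∀ x : Fin n, (cycleInterval σ x).card ≤ 4) ↔ sameCycleFamily.Good σ := by
  have hmem : ∀ x y, y ∈ cycleElements σ x ↔ σ.SameCycle x y := by simp [cycleElements]
  simp only [cycleInterval, Fin.card_Icc]
  constructor
  · intro h x y hxy
    have hmin := Finset.min'_le _ x ((hmem x x).2 (Equiv.Perm.SameCycle.refl σ x))
    have hmax := Finset.le_max' _ y ((hmem x y).2 hxy)
    have := h x
    rw [Fin.le_def] at hmin hmax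
    omega
  · intro h x
    have hmin := (hmem x _).1 (Finset.min'_mem _ (cycleElements_nonempty σ x))
    have hmax := (hmem x _).1 (Finset.max'_mem _ (cycleElements_nonempty σ x))
    -- Goodness is applied to the minimum and maximum of the cycle.
    have := h _ _ (hmin.symm.trans hmax)
    omega

theorem avoidCount_oneAboveFive (n : ℕ) :
    POP.oneAboveFive.avoidCount n = insertionCount n 0 0 0 := by
  simp only [POP.avoidCount, avoids_oneAboveFive_iff]
  exact precedenceFamily.card_good n

theorem localCycleCount_four (n : ℕ) : localCycleCount 4 n = insertionCount n 0 0 0 := by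
  simp only [localCycleCount, cycleInterval_card_le_four_iff]
  exact sameCycleFamily.card_good n

theorem mainTheorem5 :
    (PowerSeries.mk (fun n : ℕ => (POP.oneAboveFive.avoidCount n : ℚ)) =
      (1 - PowerSeries.X ^ 2) *
        (1 - PowerSeries.X - 2 * PowerSeries.X ^ 2 - 2 * PowerSeries.X ^ 3
          - 12 * PowerSeries.X ^ 4 - 8 * PowerSeries.X ^ 5 + 2 * PowerSeries.X ^ 6
          + 5 * PowerSeries.X ^ 7 + PowerSeries.X ^ 8)⁻¹) ∧
    ∀ n : ℕ, POP.oneAboveFive.avoidCount n = localCycleCount 4 n := by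
  simp only [avoidCount_oneAboveFive, localCycleCount_four, implies_true, and_true]
  exact mk_insertionCount
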